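/- Regard $\mathbb{Z}^n$ as the graph whose edges are the pairs $\{x,x+e_i\}$ with $x\in\mathbb{Z}^n$ and $1\le i\le n$, where $e_1,\dots,e_n$ is the standard basis. A function $f:\mathbb{Z}^n\to\{0,1\}$ is called $p$-biased if for every vertex $x$ the fraction of the $2n$ neighbours of $x$ on which $f$ takes the value $1$ is exactly $p$. Two such functions $f,g$ are isomorphic if there is a graph automorphism $\varphi$ of $\mathbb{Z}^n$ with $g\circ\varphi=f$. **Theorem 4.1.** For every integer $n>1$ and every $c\in\{1,\dots,2n-1\}$, there are exactly $2^{\aleph_0}$ isomorphism classes of $\frac{c}{2n}$-biased functions $f:\mathbb{Z}^n\to\{0,1\}$. -/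

import Mathlib

open scoped Cardinal

/-- The graph on `ℤ^n` whose edges are the pairs `{x, x + e_i}`. -/
def zGraph (n : ℕ) : SimpleGraph (Fin n → ℤ) where
  Adj x y := ∃ i : Fin n, y = x + Pi.single i 1 ∨ x = y + Pi.single i 1
  symm := ⟨fun _ _ ⟨i, h⟩ => ⟨i, h.symm⟩⟩
  loopless := ⟨by
    rintro x ⟨i, h | h⟩ <;>
    · have h' := congrFun h i
      simp at h'⟩

/-- A 0-1 function `f` on the vertices of `G` is `p`-biased if for each vertex `v` the fraction of
the neighbours of `v` on which `f` takes the value 1 is exactly `p`. -/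
def IsBiased {V : Type*} (G : SimpleGraph V) (p : ℝ) (f : V → Fin 2) : Prop :=
  ∀ v : V, ({w ∈ G.neighborSet v | f w = 1}.ncard : ℝ) / ((G.neighborSet v).ncard : ℝ) = p

/-- The type of `p`-biased 0-1 functions on `G`. -/
abbrev BiasedFunction {V : Type*} (G : SimpleGraph V) (p : ℝ) : Type _ :=
  {f : V → Fin 2 // IsBiased G p f}

/-- Two biased functions are isomorphic if some automorphism of the graph carries one to the
other. -/
def biasedSetoid {V : Type*} (G : SimpleGraph V) (p : ℝ) : Setoid (BiasedFunction G p) where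
  r f g := ∃ φ : G ≃g G, ∀ v : V, g.1 (φ v) = f.1 v
  iseqv :=
    { refl := fun _ => ⟨RelIso.refl _, fun _ => rfl⟩
      symm := fun {f g} ⟨φ, h⟩ => ⟨φ.symm, fun v => by
        rw [← h (φ.symm v), RelIso.apply_symm_apply]⟩
      trans := fun {f g k} ⟨φ, h⟩ ⟨ψ, h'⟩ => ⟨φ.trans ψ, fun v => by
        rw [RelIso.trans_apply, h', h]⟩ }

/-!
In `ℤ^n` two distinct neighbours `y`, `z` of a vertex `x` have no common neighbours besides `x` and
`y + z - x`. Hence automorphisms preserve elementary parallelograms, so each one is determined by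
its values on `0, e_1, …, e_n`: there are only countably many, isomorphism classes are countable,
and it suffices to find `2 ^ ℵ₀` biased functions.

For these, the homomorphism `ℤ^n → ℤ × ℤ/n` with `e_i ↦ (1, i)` is a covering of the graph on
`ℤ × ℤ/n` in which all vertices on consecutive levels are adjacent. There the indicator function of
a set is `c / (2 * n)`-biased as soon as its sections at levels `s - 1` and `s + 1` always have `c`
elements in total. Prescribing the section sizes `k, k, c - k, c - k` periodically with
`0 < k < n` and `c - k ≤ n` leaves at least two choices for infinitely many sections.
-/

open Function

universe u

section Automorphisms

variable {n : ℕ} {x y z w : Fin n → ℤ}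

lemma zGraph_adj_add_single (i : Fin n) (x : Fin n → ℤ) : (zGraph n).Adj x (x + Pi.single i 1) :=
  ⟨i, .inl rfl⟩

lemma zGraph_adj_add_sub (hxz : (zGraph n).Adj x z) (y : Fin n → ℤ) :
    (zGraph n).Adj y (y + z - x) := by
  obtain ⟨i, rfl | rfl⟩ := hxz
  · exact ⟨i, .inl (by abel)⟩
  · exact ⟨i, .inr (by abel)⟩

lemma dotProduct_sub_self_of_zGraph_adj (h : (zGraph n).Adj x y) :
    (y - x) ⬝ᵥ (y - x) = 1 := by
  obtain ⟨i, rfl | rfl⟩ := h <;> simp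

lemma dotProduct_nonpos_of_dotProduct_self_eq_one {ι : Type*} [Fintype ι] {a b : ι → ℤ}
    (ha : a ⬝ᵥ a = 1) (hb : b ⬝ᵥ b = 1) (hab : a ≠ b) : a ⬝ᵥ b ≤ 0 := by
  have hpos : 0 < (a - b) ⬝ᵥ (a - b) := by
    simpa only [star_trivial] using Matrix.dotProduct_self_star_pos_iff.2 (sub_ne_zero.2 hab)
  simp only [sub_dotProduct, dotProduct_sub, ha, hb, dotProduct_comm b a] at hpos
  omega

lemma eq_or_eq_add_sub_of_zGraph_adj (hxy : (zGraph n).Adj x y) (hxz : (zGraph n).Adj x z)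
    (hyz : y ≠ z) (hyw : (zGraph n).Adj y w) (hzw : (zGraph n).Adj z w) :
    w = x ∨ w = y + z - x := by
  by_contra! hw
  have ha := dotProduct_sub_self_of_zGraph_adj hxy
  have hb := dotProduct_sub_self_of_zGraph_adj hxz
  have hs := dotProduct_sub_self_of_zGraph_adj hyw.symm
  have ht := dotProduct_sub_self_of_zGraph_adj hzw
  have hab : (y - x) ⬝ᵥ (z - x) ≤ 0 :=
    dotProduct_nonpos_of_dotProduct_self_eq_one ha hb fun h => hyz (sub_left_injective h)
  have has : (y - x) ⬝ᵥ (y - w) ≤ 0 :=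
    dotProduct_nonpos_of_dotProduct_self_eq_one ha hs fun h => hw.1 (sub_right_injective h).symm
  have hat : (y - x) ⬝ᵥ (w - z) ≤ 0 :=
    dotProduct_nonpos_of_dotProduct_self_eq_one ha ht fun h => hw.2 (by linear_combination -h)
  have hsum : (y - x) ⬝ᵥ (y - x) =
      (y - x) ⬝ᵥ (z - x) + (y - x) ⬝ᵥ (y - w) + (y - x) ⬝ᵥ (w - z) := by
    rw [← dotProduct_add, ← dotProduct_add]
    congr 1
    abel
  omega

lemma zGraph_iso_parallelogram (φ : zGraph n ≃g zGraph n) (hxy : (zGraph n).Adj x y)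
    (hxz : (zGraph n).Adj x z) (hyz : y ≠ z) : φ (y + z - x) = φ y + φ z - φ x := by
  have hφy := φ.map_adj_iff.2 hxy
  have hφz := φ.map_adj_iff.2 hxz
  have hyw := zGraph_adj_add_sub hxz y
  have hzw : (zGraph n).Adj z (y + z - x) := add_comm z y ▸ zGraph_adj_add_sub hxy z
  obtain h | h := eq_or_eq_add_sub_of_zGraph_adj hφy hφz (φ.injective.ne hyz)
    (φ.map_adj_iff.2 hyw) (φ.map_adj_iff.2 hzw)
  · -- Here `y + z - x = x`, so the fourth vertex of the image must pull back to `x` as well.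
    obtain ⟨w, hw⟩ := φ.surjective (φ y + φ z - φ x)
    have hφyw : (zGraph n).Adj (φ y) (φ w) := hw ▸ zGraph_adj_add_sub hφz (φ y)
    have hφzw : (zGraph n).Adj (φ z) (φ w) := by
      rw [hw, add_comm]
      exact zGraph_adj_add_sub hφy (φ z)
    have hwx : w = x ∨ w = y + z - x := eq_or_eq_add_sub_of_zGraph_adj hxy hxz hyz
      (φ.map_adj_iff.1 hφyw) (φ.map_adj_iff.1 hφzw)
    rcases hwx with rfl | rfl
    · exact h.trans hw
    · exact hw
  · exact h

lemma periodic_of_periodic_single {ι α : Type*} [Finite ι] [DecidableEq ι] {f : (ι → ℤ) → α}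
    (hf : ∀ i, Periodic f (Pi.single i 1)) (c : ι → ℤ) : Periodic f c := by
  cases nonempty_fintype ι
  rw [pi_eq_sum_univ' c]
  exact Finset.sum_induction _ (Periodic f) (fun _ _ => Periodic.add_period)
    (periodic_with_period_zero f) fun i _ => (hf i).zsmul (c i)

lemma periodic_zGraph_iso_sub (φ : zGraph n ≃g zGraph n) (i j : Fin n) :
    Periodic (fun x => φ (x + Pi.single i 1) - φ x) (Pi.single j 1) := by
  intro x
  obtain rfl | hij := eq_or_ne i j
  · have h := zGraph_iso_parallelogram φ (zGraph_adj_add_single i x).symm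
      (zGraph_adj_add_single i (x + Pi.single i 1)) (by simp [add_assoc, ← Pi.single_add])
    rw [show x + (x + Pi.single i 1 + Pi.single i 1) - (x + Pi.single i 1) = x + Pi.single i 1 by
      abel] at h
    linear_combination -h
  · have h := zGraph_iso_parallelogram φ (zGraph_adj_add_single i x) (zGraph_adj_add_single j x)
      fun h => by simpa [hij] using congrFun (add_left_cancel h) i
    rw [show x + Pi.single i 1 + (x + Pi.single j 1) - x = x + Pi.single j 1 + Pi.single i 1 by
      abel] at h
    linear_combination h

lemma zGraph_iso_add_single (φ : zGraph n ≃g zGraph n) (i : Fin n) (x : Fin n → ℤ) :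
    φ (x + Pi.single i 1) - φ x = φ (Pi.single i 1) - φ 0 := by
  simpa only [zero_add] using (periodic_of_periodic_single (periodic_zGraph_iso_sub φ i) x).eq

lemma zGraph_iso_ext {φ ψ : zGraph n ≃g zGraph n} (h₀ : φ 0 = ψ 0)
    (h : ∀ i, φ (Pi.single i 1) = ψ (Pi.single i 1)) : φ = ψ := by
  have hper (i : Fin n) : Periodic (fun x => φ x - ψ x) (Pi.single i 1) := fun x => by
    linear_combination zGraph_iso_add_single φ i x - zGraph_iso_add_single ψ i x + h i - h₀
  refine RelIso.ext fun x => sub_eq_zero.1 ?_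
  exact (periodic_of_periodic_single hper x).eq.trans (sub_eq_zero.2 h₀)

instance : Countable (zGraph n ≃g zGraph n) := by
  refine Injective.countable
    (f := fun φ : zGraph n ≃g zGraph n => (φ 0, fun i => φ (Pi.single i 1))) fun φ ψ h => ?_
  exact zGraph_iso_ext (congrArg Prod.fst h) (congrFun (congrArg Prod.snd h))

end Automorphisms

section Counting

lemma mk_quotient_eq_mk_of_countable {α : Type*} [Uncountable α] (s : Setoid α)
    (hs : ∀ a, {b | s b a}.Countable) : #(Quotient s) = #α := by
  refine Cardinal.mk_quotient_le.antisymm (not_lt.1 fun hlt => ?_)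
  have hle : #α ≤ #(Quotient s) * ℵ₀ := by
    refine Cardinal.mk_le_mk_mul_of_mk_preimage_le (Quotient.mk s) fun q => ?_
    induction q using Quotient.inductionOn with | h a => ?_
    simpa only [Set.preimage, Set.mem_singleton_iff, Quotient.eq] using (hs a).le_aleph0
  have hα : ℵ₀ < #α := Cardinal.aleph0_lt_mk
  exact hle.not_gt (Cardinal.mul_lt_of_lt hα.le hlt hα)

variable {V : Type*} (G : SimpleGraph V) (p : ℝ)

lemma countable_setOf_biasedSetoid [Countable (G ≃g G)] (f : BiasedFunction G p) :
    {g | biasedSetoid G p g f}.Countable := by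
  have hunion : {g | biasedSetoid G p g f} = ⋃ φ : G ≃g G, {g | ∀ v, f.1 (φ v) = g.1 v} := by
    ext g
    rw [Set.mem_iUnion]
    rfl
  rw [hunion]
  refine Set.countable_iUnion fun φ => Set.Subsingleton.countable fun g hg k hk => ?_
  exact Subtype.ext (funext fun v => (hg v).symm.trans (hk v))

lemma mk_biasedFunction_le [Countable V] :
    #(BiasedFunction G p) ≤ 2 ^ ℵ₀ :=
  calc #(BiasedFunction G p) ≤ #(V → Fin 2) := Cardinal.mk_subtype_le _
    _ = 2 ^ #V := by simp
    _ ≤ 2 ^ ℵ₀ := Cardinal.power_le_power_left two_ne_zero Cardinal.mk_le_aleph0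

lemma mk_quotient_biasedSetoid [Countable V] [Countable (G ≃g G)]
    (h : 2 ^ ℵ₀ ≤ #(BiasedFunction G p)) : #(Quotient (biasedSetoid G p)) = 2 ^ ℵ₀ := by
  have : Uncountable (BiasedFunction G p) :=
    Cardinal.aleph0_lt_mk_iff.1 ((Cardinal.cantor ℵ₀).trans_le h)
  rw [mk_quotient_eq_mk_of_countable _ (countable_setOf_biasedSetoid G p)]
  exact (mk_biasedFunction_le G p).antisymm h

end Counting

section Coverings

/-- A map of vertices is a covering of graphs if it maps the neighbours of each vertex bijectively
onto the neighbours of its image. -/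
def IsGraphCovering {V W : Type*} (G : SimpleGraph V) (H : SimpleGraph W) (h : V → W) : Prop :=
  ∀ v, Set.BijOn h (G.neighborSet v) (H.neighborSet (h v))

lemma IsBiased.comp_covering {V W : Type*} {G : SimpleGraph V} {H : SimpleGraph W} {h : V → W}
    {p : ℝ} {f : W → Fin 2} (hf : IsBiased H p f) (hh : IsGraphCovering G H h) :
    IsBiased G p (f ∘ h) := by
  intro v
  have hones : Set.BijOn h {w ∈ G.neighborSet v | (f ∘ h) w = 1}
      {w ∈ H.neighborSet (h v) | f w = 1} :=
    (hh v).inter_mapsTo (fun _ hw => hw) Set.inter_subset_right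
  rw [hones.ncard_eq, (hh v).ncard_eq]
  exact hf (h v)

lemma mk_biasedFunction_le_of_covering {V W : Type u} {G : SimpleGraph V} {H : SimpleGraph W}
    {h : V → W} {p : ℝ} (hh : IsGraphCovering G H h) (hsurj : Surjective h) :
    #(BiasedFunction H p) ≤ #(BiasedFunction G p) :=
  Cardinal.mk_le_of_injective
    (f := fun f : BiasedFunction H p => ⟨f.1 ∘ h, f.2.comp_covering hh⟩) fun _ _ heq =>
      Subtype.ext (hsurj.injective_comp_right (congrArg Subtype.val heq))

end Coverings

section LayerGraph

/-- The graph on `ℤ × β` in which two vertices are adjacent when their levels (first coordinates)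
are consecutive. -/
def layerGraph (β : Type*) : SimpleGraph (ℤ × β) where
  Adj a b := b.1 = a.1 + 1 ∨ b.1 = a.1 - 1
  symm := ⟨fun _ _ h => by omega⟩
  loopless := ⟨fun _ h => by omega⟩

/-- The homomorphism `ℤ^n → ℤ × ℤ/n` with `e_i ↦ (1, i)`, where `Fin n` with its cyclic addition
serves as `ℤ/n`. -/
def layerMap (n : ℕ) [NeZero n] : (Fin n → ℤ) →ₗ[ℤ] ℤ × Fin n :=
  Fintype.linearCombination ℤ fun i => (1, i)

lemma layerMap_single {n : ℕ} [NeZero n] (i : Fin n) (k : ℤ) :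
    layerMap n (Pi.single i k) = (k, k • i) := by
  simp [layerMap, Fintype.linearCombination_apply_single]

lemma layerMap_surjective (n : ℕ) [NeZero n] : Surjective (layerMap n) := fun ⟨s, r⟩ =>
  ⟨Pi.single 0 (s - 1) + Pi.single r 1, by simp [layerMap_single]⟩

lemma mem_zGraph_neighborSet {n : ℕ} {x y : Fin n → ℤ} :
    y ∈ (zGraph n).neighborSet x ↔ ∃ i, y = x + Pi.single i 1 ∨ y = x - Pi.single i 1 := by
  simp only [SimpleGraph.mem_neighborSet, zGraph, eq_sub_iff_add_eq, eq_comm]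

lemma isGraphCovering_layerMap (n : ℕ) [NeZero n] :
    IsGraphCovering (zGraph n) (layerGraph (Fin n)) (layerMap n) := by
  have hup (x : Fin n → ℤ) (i : Fin n) :
      layerMap n (x + Pi.single i 1) = ((layerMap n x).1 + 1, (layerMap n x).2 + i) := by
    rw [map_add, layerMap_single, one_smul]; rfl
  have hdown (x : Fin n → ℤ) (i : Fin n) :
      layerMap n (x - Pi.single i 1) = ((layerMap n x).1 - 1, (layerMap n x).2 - i) := by
    rw [map_sub, layerMap_single, one_smul]; rfl
  refine fun x => ⟨fun y hy => ?_, fun y hy z hz h => ?_, fun ⟨s, r⟩ h => ?_⟩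
  · obtain ⟨i, rfl | rfl⟩ := mem_zGraph_neighborSet.1 hy
    · exact .inl (by rw [hup])
    · exact .inr (by rw [hdown])
  · obtain ⟨i, rfl | rfl⟩ := mem_zGraph_neighborSet.1 hy <;>
    obtain ⟨j, rfl | rfl⟩ := mem_zGraph_neighborSet.1 hz <;>
    simp only [hup, hdown, Prod.mk.injEq, add_right_inj, sub_right_inj] at h
    · rw [h.2]
    · omega
    · omega
    · rw [h.2]
  · obtain rfl | rfl : s = (layerMap n x).1 + 1 ∨ s = (layerMap n x).1 - 1 := h
    · exact ⟨x + Pi.single (r - (layerMap n x).2) 1, mem_zGraph_neighborSet.2 ⟨_, .inl rfl⟩, by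
        rw [hup, add_sub_cancel]⟩
    · exact ⟨x - Pi.single ((layerMap n x).2 - r) 1, mem_zGraph_neighborSet.2 ⟨_, .inr rfl⟩, by
        rw [hdown, sub_sub_cancel]⟩

variable {β : Type*}

open Classical in
/-- The indicator function of the subset of `ℤ × β` with section `A s` at level `s`. -/
noncomputable def layerIndicator (A : ℤ → Set β) (a : ℤ × β) : Fin 2 :=
  if a.2 ∈ A a.1 then 1 else 0

lemma layerIndicator_eq_one {A : ℤ → Set β} {a : ℤ × β} :
    layerIndicator A a = 1 ↔ a.2 ∈ A a.1 := by
  simp [layerIndicator]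

lemma layerIndicator_injective : Injective (layerIndicator (β := β)) := fun A B h => by
  ext s r
  rw [← layerIndicator_eq_one (A := A) (a := (s, r)), h, layerIndicator_eq_one]

variable [Finite β]

lemma ncard_layerGraph_neighborSet_sep (A : ℤ → Set β) (a : ℤ × β) :
    {b ∈ (layerGraph β).neighborSet a | b.2 ∈ A b.1}.ncard =
      (A (a.1 + 1)).ncard + (A (a.1 - 1)).ncard := by
  have hunion : {b ∈ (layerGraph β).neighborSet a | b.2 ∈ A b.1} =
      {a.1 + 1} ×ˢ A (a.1 + 1) ∪ {a.1 - 1} ×ˢ A (a.1 - 1) := by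
    ext ⟨s, r⟩
    simp only [SimpleGraph.mem_neighborSet, layerGraph, Set.mem_ofPred_eq, Set.mem_union,
      Set.mem_prod, Set.mem_singleton_iff]
    grind
  have hdisj : Disjoint ({a.1 + 1} ×ˢ A (a.1 + 1)) ({a.1 - 1} ×ˢ A (a.1 - 1)) :=
    Set.disjoint_prod.2 (.inl (Set.disjoint_singleton.2 (by omega)))
  rw [hunion, Set.ncard_union_eq hdisj (Set.toFinite _) (Set.toFinite _), Set.ncard_prod,
    Set.ncard_prod, Set.ncard_singleton, Set.ncard_singleton, one_mul, one_mul]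

lemma ncard_layerGraph_neighborSet (a : ℤ × β) :
    ((layerGraph β).neighborSet a).ncard = 2 * Nat.card β := by
  simpa only [Set.mem_univ, and_true, Set.ofPred_mem_eq, Set.ncard_univ, ← two_mul] using
    ncard_layerGraph_neighborSet_sep (fun _ => Set.univ) a

lemma isBiased_layerIndicator {A : ℤ → Set β} {c : ℕ}
    (hA : ∀ s, (A (s + 1)).ncard + (A (s - 1)).ncard = c) :
    IsBiased (layerGraph β) ((c : ℝ) / (2 * (Nat.card β : ℝ))) (layerIndicator A) := by
  intro a
  simp only [layerIndicator_eq_one, ncard_layerGraph_neighborSet_sep, hA,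
    ncard_layerGraph_neighborSet, Nat.cast_mul, Nat.cast_ofNat]

lemma two_power_aleph0_le_mk_biasedFunction_layerGraph {β : Type} [Finite β] {c : ℕ}
    (hβ : 1 < Nat.card β) (hc : 1 ≤ c) (hc' : c ≤ 2 * Nat.card β - 1) :
    2 ^ ℵ₀ ≤ #(BiasedFunction (layerGraph β) ((c : ℝ) / (2 * (Nat.card β : ℝ)))) := by
  obtain ⟨k, hk₀, hkβ, hkc, hck⟩ : ∃ k, 0 < k ∧ k < Nat.card β ∧ k ≤ c ∧ c - k ≤ Nat.card β :=
    ⟨max 1 (c / 2), by omega⟩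
  have : Nontrivial (Set.powersetCard β k) := Set.powersetCard.nontrivial' hk₀ hkβ
  obtain ⟨C, -, hC⟩ : ∃ C ⊆ (Set.univ : Set β), C.ncard = c - k :=
    Set.exists_subset_card_eq (by rwa [Set.ncard_univ])
  let A (S : ℤ → Set.powersetCard β k) (s : ℤ) : Set β := if s % 4 < 2 then S (s / 4) else C
  have hA_ncard (S : ℤ → Set.powersetCard β k) (s : ℤ) :
      (A S (s + 1)).ncard + (A S (s - 1)).ncard = c := by
    simp only [A]
    split_ifs <;> simp only [Set.powersetCard.ncard_eq, hC] <;> omega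
  have hA_injective : Injective A := fun S T h => funext fun j => by
    simpa [A] using congrFun h (4 * j)
  calc (2 : Cardinal) ^ ℵ₀ ≤ #(Set.powersetCard β k) ^ ℵ₀ :=
        Cardinal.power_le_power_right (Cardinal.two_le_iff.2 (exists_pair_ne _))
    _ = #(ℤ → Set.powersetCard β k) := by simp
    _ ≤ #(BiasedFunction (layerGraph β) ((c : ℝ) / (2 * (Nat.card β : ℝ)))) :=
        Cardinal.mk_le_of_injective
          (f := fun S => ⟨layerIndicator (A S), isBiased_layerIndicator (hA_ncard S)⟩)
          fun _ _ h => hA_injective (layerIndicator_injective (congrArg Subtype.val h))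

end LayerGraph

theorem theorem4p1 (n : ℕ) (hn : 1 < n) (c : ℕ) (hc : 1 ≤ c) (hc' : c ≤ 2 * n - 1) :
    #(Quotient (biasedSetoid (zGraph n) ((c : ℝ) / (2 * (n : ℝ))))) = 2 ^ ℵ₀ := by
  have : NeZero n := ⟨by omega⟩
  have hlayer : 2 ^ ℵ₀ ≤ #(BiasedFunction (layerGraph (Fin n)) ((c : ℝ) / (2 * (n : ℝ)))) := by
    rw [← Nat.card_fin n] at hn hc'
    simpa only [Nat.card_fin] using two_power_aleph0_le_mk_biasedFunction_layerGraph hn hc hc'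
  refine mk_quotient_biasedSetoid _ _ (hlayer.trans ?_)
  exact mk_biasedFunction_le_of_covering (isGraphCovering_layerMap n) (layerMap_surjective n)
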